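/- A \emph{tangle} on $N\ge 0$ strands is a perfect matching $X$ of the $2N$ nodes $1,\dots,N$ (upper row) and $1',\dots,N'$ (lower row); its pairs are its \emph{edges}, and the \emph{size} of an edge $e$ joining nodes in columns $x$ and $y$ (in either row) is $|e|=|x-y|$. Tangles are composed by stacking (the first factor on top), tracing edges through the stack and ignoring closed loops. For $1\le i\le N-1$ the prime $T_i$ has the edges $(i,(i+1)')$, $(i+1,i')$ and $(k,k')$ for $k\ne i,i+1$; the prime $U_i$ has the edges $(i,i+1)$, $(i',(i+1)')$ and $(k,k')$ for $k\ne i,i+1$. A \emph{factorization} of $X$ is a finite word $F$ in the primes $T_i,U_i$ whose composition is $X$ (the empty word composes to the identity tangle with edges $(k,k')$); it is \emph{minimal} if no shorter word composes to $X$. An edge $e$ of $X$ \emph{passes through} a letter $p_i\in\{T_i,U_i\}$ of $F$ if, in the stacked diagram of $F$, $e$ is connected to the upper node $i$ or the lower node $i'$ of that letter. Let $\#T(e)$ and $\#U(e)$ be the number of letters of $F$ that are $T$-primes, respectively $U$-primes, through which $e$ passes. The edge $e$ \emph{comes back} in $F$ if, when $e$ is traced through the stacked diagram from one end to the other, there is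 a letter of $F$ at which the distance between the column of the starting end and the current column decreases. Let $X$ be a tangle, $F$ a minimal factorization of $X$ and $e$ an edge of $X$, traced from either of its ends. Then: \begin{enumerate} \item if $\#U(e)>0$, then $e$ does not come back in $F$; \item if $\#T(e)\ge |e|$, then $\#U(e)=0$; \item if $\#T(e)<|e|$, then $\#T(e)+\#U(e)=|e|$. \end{enumerate} -/

import Mathlib

/-- The `2N` nodes of a tangle: `Sum.inl k` is the `k`-th node of the upper row and `Sum.inr k`
the `k`-th node of the lower row (columns are numbered from `0`). -/
abbrev Node (N : ℕ) : Type := Fin N ⊕ Fin N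

/-- The column of a node. -/
def Node.col {N : ℕ} : Node N → Fin N
  | Sum.inl k => k
  | Sum.inr k => k

/-- Horizontal distance of two columns. -/
def colDist {N : ℕ} (a b : Fin N) : ℕ := ((a : ℤ) - (b : ℤ)).natAbs

/-- A tangle, i.e. a perfect matching of the `2N` nodes, recorded by the fixed-point-free
involution which sends each node to the other end of its edge.  The edges of `X` are the pairs
`(u, v)` with `X.partner u = v`. -/
@[ext]
structure Tangle (N : ℕ) where
  partner : Node N → Node N
  partner_partner : ∀ u, partner (partner u) = u
  partner_ne : ∀ u, partner u ≠ u

/-- The size `|e|` of the edge with ends `u` and `v`. -/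
def edgeSize {N : ℕ} (u v : Node N) : ℕ := colDist u.col v.col

/-- A letter `T_i` or `U_i`; it acts on the adjacent columns `i` and `i + 1`. -/
inductive PrimeTangle (N : ℕ) where
  | T (i : ℕ) (h : i + 1 < N) : PrimeTangle N
  | U (i : ℕ) (h : i + 1 < N) : PrimeTangle N

namespace PrimeTangle

variable {N : ℕ}

/-- The column `i` of the prime `T_i` or `U_i`. -/
def left : PrimeTangle N → Fin N
  | T i h => ⟨i, (Nat.lt_succ_self i).trans h⟩
  | U i h => ⟨i, (Nat.lt_succ_self i).trans h⟩

/-- The column `i + 1` of the prime `T_i` or `U_i`. -/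
def right : PrimeTangle N → Fin N
  | T i h => ⟨i + 1, h⟩
  | U i h => ⟨i + 1, h⟩

/-- The prime is one of the `T_i`. -/
def IsT : PrimeTangle N → Prop
  | T _ _ => True
  | U _ _ => False

/-- The prime is one of the `U_i`. -/
def IsU : PrimeTangle N → Prop
  | T _ _ => False
  | U _ _ => True

end PrimeTangle

/-- The tangle in which the upper nodes `a`, `b` are joined to the lower nodes `b`, `a`
and every other node to the one below or above it. -/
def crossTangle {N : ℕ} (a b : Fin N) : Tangle N where
  partner
    | Sum.inl k => Sum.inr (Equiv.swap a b k)
    | Sum.inr k => Sum.inl (Equiv.swap a b k)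
  partner_partner := by rintro (k | k) <;> simp
  partner_ne := by rintro (k | k) <;> simp

/-- The tangle in which the upper nodes `a`, `b` are joined, the lower nodes `a`, `b` are joined
and every other node is joined to the one below or above it. -/
def hookTangle {N : ℕ} (a b : Fin N) (hab : a ≠ b) : Tangle N where
  partner
    | Sum.inl k => if k = a then Sum.inl b else if k = b then Sum.inl a else Sum.inr k
    | Sum.inr k => if k = a then Sum.inr b else if k = b then Sum.inr a else Sum.inl k
  partner_partner := by
    rintro (k | k) <;> dsimp only <;> split_ifs <;> simp_all
  partner_ne := by
    rintro (k | k) <;> dsimp only <;> split_ifs <;> simp_all [eq_comm]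

namespace PrimeTangle

variable {N : ℕ}

theorem left_ne_right (p : PrimeTangle N) : p.left ≠ p.right := by
  cases p <;> simp [left, right]

/-- The prime as a tangle. -/
def toTangle : PrimeTangle N → Tangle N
  | T i h => crossTangle (T i h).left (T i h).right
  | U i h => hookTangle (U i h).left (U i h).right (left_ne_right _)

end PrimeTangle

section Stack

variable {N n : ℕ}

/-- Stacking `n` tangles on top of each other (the `0`-th on top) produces `n + 1` rows of `N`
points.  The upper row of the `j`-th tangle is row `j`, its lower row is row `j + 1`. -/
def place (j : Fin n) : Node N → Fin (n + 1) × Fin N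
  | Sum.inl k => (j.castSucc, k)
  | Sum.inr k => (j.succ, k)

/-- The points `a` and `b` of the stack are the ends of an edge of the `j`-th tangle. -/
def Strand (L : Fin n → Tangle N) (j : Fin n) (a b : Fin (n + 1) × Fin N) : Prop :=
  ∃ p : Node N, a = place j p ∧ b = place j ((L j).partner p)

theorem Strand.symm {L : Fin n → Tangle N} {j : Fin n} {a b : Fin (n + 1) × Fin N}
    (h : Strand L j a b) : Strand L j b a := by
  obtain ⟨p, rfl, rfl⟩ := h
  exact ⟨(L j).partner p, rfl, by rw [(L j).partner_partner]⟩

theorem place_injective (j : Fin n) : Function.Injective (place (N := N) j) := by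
  rintro (k | k) (l | l) h <;> simp_all [place, Fin.ext_iff]

theorem Strand.ne {L : Fin n → Tangle N} {j : Fin n} {a b : Fin (n + 1) × Fin N}
    (h : Strand L j a b) : a ≠ b := by
  obtain ⟨p, rfl, rfl⟩ := h
  exact fun h => (L j).partner_ne p (place_injective j h).symm

/-- The stacked diagram. -/
def stack (L : Fin n → Tangle N) : SimpleGraph (Fin (n + 1) × Fin N) where
  Adj a b := ∃ j, Strand L j a b
  symm := ⟨fun _ _ ⟨j, h⟩ => ⟨j, h.symm⟩⟩
  loopless := ⟨fun _ ⟨_, h⟩ => h.ne rfl⟩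

/-- The outer nodes of the stack: the upper row is the first row and the lower row the last. -/
def outer (n : ℕ) {N : ℕ} : Node N → Fin (n + 1) × Fin N
  | Sum.inl k => (0, k)
  | Sum.inr k => (Fin.last n, k)

/-- `X` is the composition `L 0 ∘ L 1 ∘ ⋯ ∘ L (n - 1)`: each edge of `X` joins two outer nodes that
are connected by tracing through the stacked diagram (internal loops are ignored; for `n = 0` this
says that `X` is the identity tangle). -/
def IsComposition (L : Fin n → Tangle N) (X : Tangle N) : Prop :=
  ∀ u : Node N, (stack L).Reachable (outer n u) (outer n (X.partner u))

end Stack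

section Factorization

variable {N : ℕ}

/-- The tangles to be stacked for a word in the primes (the first letter on top). -/
def layers (F : List (PrimeTangle N)) : Fin F.length → Tangle N :=
  fun j => (F.get j).toTangle

/-- The word `F` is a factorization of `X`. -/
def IsFactorization (F : List (PrimeTangle N)) (X : Tangle N) : Prop :=
  IsComposition (layers F) X

/-- `F` is a factorization of `X` and no word for `X` is shorter. -/
def IsMinimalFactorization (F : List (PrimeTangle N)) (X : Tangle N) : Prop :=
  IsFactorization F X ∧ ∀ F' : List (PrimeTangle N), IsFactorization F' X → F.length ≤ F'.length

/-- The edge that starts at the outer node `u` passes through the `j`-th letter `p_i` of `F`: it is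
connected to the upper or to the lower node in column `i` of that letter. -/
def PassesThrough (F : List (PrimeTangle N)) (u : Node N) (j : Fin F.length) : Prop :=
  (stack (layers F)).Reachable (outer F.length u) (place j (Sum.inl (F.get j).left)) ∨
  (stack (layers F)).Reachable (outer F.length u) (place j (Sum.inr (F.get j).left))

/-- `#T(e)`, the number of `T`-primes of `F` that the edge `e` starting at `u` passes through. -/
noncomputable def numT (F : List (PrimeTangle N)) (u : Node N) : ℕ :=
  {j : Fin F.length | (F.get j).IsT ∧ PassesThrough F u j}.ncard

/-- `#U(e)`, the number of `U`-primes of `F` that the edge `e` starting at `u` passes through. -/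
noncomputable def numU (F : List (PrimeTangle N)) (u : Node N) : ℕ :=
  {j : Fin F.length | (F.get j).IsU ∧ PassesThrough F u j}.ncard

/-- The edge `e` from `u` to `v` comes back at the `j`-th letter of `F`: following the path of `e`
from `u` to `v` in the stacked diagram, there is a step along an edge of that letter at which the
size of the part of `e` traced so far decreases. -/
def ComesBackAt (F : List (PrimeTangle N)) (u v : Node N) (j : Fin F.length) : Prop :=
  ∃ w : (stack (layers F)).Walk (outer F.length u) (outer F.length v), w.IsPath ∧
    ∃ d ∈ w.darts, Strand (layers F) j d.fst d.snd ∧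
      colDist u.col d.snd.2 < colDist u.col d.fst.2

/-- The edge from `u` to `v` comes back in `F`. -/
def ComesBack (F : List (PrimeTangle N)) (u v : Node N) : Prop :=
  ∃ j : Fin F.length, ComesBackAt F u v j

end Factorization

/-!
All three claims follow from the first one together with a count. Trace an edge `e` through the
stacked diagram. Each step along a letter changes the column by at most one, and it changes the
column exactly when `e` passes through the letter by this step. Hence every distance below `|e|` is
overcome at some letter, so `|e| ≤ #T(e) + #U(e)` in every factorization
(`IsTrace.edgeSize_le_ncard`), with equality if `e` does not come back
(`IsTrace.ncard_le_edgeSize`). If `#U(e) > 0`, the first claim gives equality, which excludes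
`#T(e) ≥ |e|`; if `#U(e) = 0`, the inequality excludes `#T(e) < |e|`.

For the first claim, let `e` pass through a letter `U` and come back. Then `e` runs along a hook and
takes two steps in opposite horizontal directions. Hence, up to the direction of the trace, `e` runs
along a hook, then in the same horizontal direction through crossings only, and then turns back at
some letter (`reducible_of_hook`). Up to reflections of the diagram, the strand leaves the hook of
some `U_i` downwards and to the right (`reducible_of_turn`). Letters to the right of the strand
commute to the front, letters to the left of it commute past the later crossings of the strand
(`TurnsBack.reducible`), and what remains is a word `U_i T_{i+1} ⋯ T_{i+k} L p` with `p` in the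
columns `i + k`, `i + k + 1` and `L` in columns up to `i + k`. Such a word is not minimal
(`reducible_hook_crossRun`): `L` can be rewritten, without becoming longer, so that at most one of
its letters acts on the column `i + k` (`exists_simplifies_atMostOneTop`). Then either `p` meets a
letter in the same two columns, or three letters `p_{j+1} q_j r_{j+1}` meet. By the relations of the
Brauer monoid these shorten, except for `T_{j+1} T_j T_{j+1} = T_j T_{j+1} T_j` and `T_{j+1} U_j
T_{j+1} = T_j U_{j+1} T_j`, which replace `k` by `k - 1`. For `k = 0` the first letter is `U_i`, and
the word always shortens.

Words are compared by means of colourings: a word relates a colouring of the top row to a colouring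
of the bottom row if both extend to a colouring of the stacked diagram that is constant on strands
(`wordRel`). Stacking becomes composition of relations, closed loops are ignored automatically, and
`isFactorization_iff` recovers the tangle from the relation. For the sake of the reflections, the
columns of words are indexed by `ℤ`.
-/

/-! ### Words and colourings -/

/-- A letter `T_i` (`cross i`) or `U_i` (`hook i`), with columns indexed by all integers. -/
inductive Letter where
  | cross (i : ℤ) : Letter
  | hook (i : ℤ) : Letter

namespace Letter

/-- The left one of the two columns on which the letter acts. -/
def idx : Letter → ℤ
  | cross i => i
  | hook i => i

@[simp] theorem idx_cross (i : ℤ) : (cross i).idx = i := rfl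

@[simp] theorem idx_hook (i : ℤ) : (hook i).idx = i := rfl

/-- The colourings `f` of the upper and `g` of the lower row are constant on the edges of the
letter. -/
def Rel {C : Type} (p : Letter) (f g : ℤ → C) : Prop :=
  (∀ k, k ≠ p.idx → k ≠ p.idx + 1 → f k = g k) ∧
  match p with
  | cross i => f i = g (i + 1) ∧ f (i + 1) = g i
  | hook i => f i = f (i + 1) ∧ g i = g (i + 1)

/-- The reflection of a letter in the vertical line through column `0`. -/
def mirror : Letter → Letter
  | cross i => cross (-i - 1)
  | hook i => hook (-i - 1)

@[simp] theorem idx_mirror (p : Letter) : p.mirror.idx = -p.idx - 1 := by cases p <;> rfl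

@[simp] theorem mirror_mirror (p : Letter) : p.mirror.mirror = p := by
  cases p <;> simp [mirror]

@[simp] theorem map_mirror_map_mirror (P : List Letter) :
    (P.map mirror).map mirror = P := by
  simp [List.map_map, (funext mirror_mirror : mirror ∘ mirror = id)]

theorem Rel.symm {C : Type} {p : Letter} {f g : ℤ → C} (h : p.Rel f g) : p.Rel g f := by
  cases p <;> simp only [Rel] at h ⊢ <;> grind

theorem Rel.mirror {C : Type} {p : Letter} {f g : ℤ → C} (h : p.Rel f g) :
    p.mirror.Rel (fun k => f (-k)) (fun k => g (-k)) := by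
  cases p with
  | cross i =>
    obtain ⟨h, h1, h2⟩ := h
    refine ⟨fun k hk hk' => h _ ?_ ?_, ?_, ?_⟩ <;> simp [Letter.mirror, idx] at * <;> grind
  | hook i =>
    obtain ⟨h, h1, h2⟩ := h
    refine ⟨fun k hk hk' => h _ ?_ ?_, ?_, ?_⟩ <;> simp [Letter.mirror, idx] at * <;> grind

end Letter

/-- The colourings `f` of the top and `g` of the bottom row extend to a colouring of the stacked
diagram of the word which is constant on all edges of all letters. -/
def wordRel {C : Type} : List Letter → (ℤ → C) → (ℤ → C) → Prop
  | [], f, g => f = g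
  | p :: P, f, g => ∃ h, p.Rel f h ∧ wordRel P h g

theorem wordRel_append {C : Type} (P Q : List Letter) (f g : ℤ → C) :
    wordRel (P ++ Q) f g ↔ ∃ h, wordRel P f h ∧ wordRel Q h g := by
  induction P generalizing f with
  | nil => simp [wordRel]
  | cons p P ih => simp only [List.cons_append, wordRel, ih]; grind

theorem wordRel_reverse {C : Type} {P : List Letter} {f g : ℤ → C} (h : wordRel P f g) :
    wordRel P.reverse g f := by
  induction P generalizing f with
  | nil => exact Eq.symm h
  | cons p P ih =>
    obtain ⟨h, h1, h2⟩ := h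
    rw [List.reverse_cons, wordRel_append]
    exact ⟨h, ih h2, f, h1.symm, rfl⟩

theorem wordRel_mirror {C : Type} {P : List Letter} {f g : ℤ → C} (h : wordRel P f g) :
    wordRel (P.map Letter.mirror) (fun k => f (-k)) (fun k => g (-k)) := by
  induction P generalizing f with
  | nil => cases h; rfl
  | cons p P ih =>
    obtain ⟨h, h1, h2⟩ := h
    exact ⟨_, h1.mirror, ih h2⟩

/-- The word `Q` is no longer than `P`, uses only letters in columns used by `P`, and may replace
`P` in every factorization. -/
structure Simplifies (P Q : List Letter) : Prop where
  length_le : Q.length ≤ P.length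
  idx_mem : ∀ q ∈ Q, ∃ p ∈ P, q.idx = p.idx
  rel : ∀ (C : Type) (f g : ℤ → C), wordRel Q f g → wordRel P f g

/-- The word `P` can be replaced by a strictly shorter one. -/
def Reducible (P : List Letter) : Prop := ∃ Q, Simplifies P Q ∧ Q.length < P.length

namespace Simplifies

variable {P Q R : List Letter}

theorem refl (P : List Letter) : Simplifies P P :=
  ⟨le_rfl, fun q hq => ⟨q, hq, rfl⟩, fun _ _ _ => id⟩

theorem trans (h : Simplifies P Q) (h' : Simplifies Q R) : Simplifies P R where
  length_le := h'.length_le.trans h.length_le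
  idx_mem r hr := by
    obtain ⟨q, hq, e⟩ := h'.idx_mem r hr
    obtain ⟨p, hp, e'⟩ := h.idx_mem q hq
    exact ⟨p, hp, e.trans e'⟩
  rel C f g H := h.rel C f g (h'.rel C f g H)

theorem append {P' Q' : List Letter} (h : Simplifies P Q) (h' : Simplifies P' Q') :
    Simplifies (P ++ P') (Q ++ Q') where
  length_le := by simpa using add_le_add h.length_le h'.length_le
  idx_mem q hq := by
    rcases List.mem_append.1 hq with hq | hq
    · obtain ⟨p, hp, e⟩ := h.idx_mem q hq
      exact ⟨p, List.mem_append_left _ hp, e⟩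
    · obtain ⟨p, hp, e⟩ := h'.idx_mem q hq
      exact ⟨p, List.mem_append_right _ hp, e⟩
  rel C f g H := by
    rw [wordRel_append] at H ⊢
    obtain ⟨k, h1, h2⟩ := H
    exact ⟨k, h.rel C _ _ h1, h'.rel C _ _ h2⟩

theorem congr (h : Simplifies P Q) (A B : List Letter) :
    Simplifies (A ++ P ++ B) (A ++ Q ++ B) := ((refl A).append h).append (refl B)

theorem reverse (h : Simplifies P Q) : Simplifies P.reverse Q.reverse where
  length_le := by simpa using h.length_le
  idx_mem := by simpa using h.idx_mem
  rel C f g H := wordRel_reverse (h.rel C g f (by simpa using wordRel_reverse H))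

theorem mirror (h : Simplifies P Q) : Simplifies (P.map Letter.mirror) (Q.map Letter.mirror) where
  length_le := by simpa using h.length_le
  idx_mem := by simpa using h.idx_mem
  rel C f g H := by
    have := wordRel_mirror H
    rw [Letter.map_mirror_map_mirror] at this
    simpa using wordRel_mirror (h.rel C _ _ this)

/-- Letters that act on disjoint pairs of columns commute. -/
theorem swap {p q : Letter} (h : p.idx + 2 ≤ q.idx ∨ q.idx + 2 ≤ p.idx) :
    Simplifies [p, q] [q, p] where
  length_le := le_rfl
  idx_mem := by simp
  rel C f g H := by
    simp only [wordRel, exists_eq_right] at H ⊢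
    obtain ⟨m, h1, h2⟩ := H
    refine ⟨fun k => if k = p.idx ∨ k = p.idx + 1 then g k else f k, ?_⟩
    cases p <;> cases q <;> simp only [Letter.Rel, Letter.idx] at * <;> grind

theorem cons_comm {p : Letter} (h : ∀ q ∈ P, p.idx + 2 ≤ q.idx ∨ q.idx + 2 ≤ p.idx) :
    Simplifies (p :: P) (P ++ [p]) := by
  induction P with
  | nil => exact refl _
  | cons q P ih =>
    exact ((swap (h q (by simp))).append (refl P)).trans
      ((refl [q]).append (ih fun r hr => h r (by simp [hr])))

theorem comm_cons {p : Letter} (h : ∀ q ∈ P, p.idx + 2 ≤ q.idx ∨ q.idx + 2 ≤ p.idx) :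
    Simplifies (P ++ [p]) (p :: P) := by
  simpa using (cons_comm (P := P.reverse) (p := p) (by simpa using h)).reverse

end Simplifies

section Words

open Letter

namespace Reducible

variable {P Q : List Letter}

theorem of_simplifies (h : Simplifies P Q) (hQ : Reducible Q) : Reducible P := by
  obtain ⟨R, h1, h2⟩ := hQ
  exact ⟨R, h.trans h1, h2.trans_le h.length_le⟩

theorem congr (h : Reducible P) (A B : List Letter) : Reducible (A ++ P ++ B) := by
  obtain ⟨R, h1, h2⟩ := h
  exact ⟨_, h1.congr A B, by simpa using h2⟩

theorem reverse (h : Reducible P) : Reducible P.reverse := by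
  obtain ⟨R, h1, h2⟩ := h
  exact ⟨_, h1.reverse, by simpa using h2⟩

theorem mirror (h : Reducible P) : Reducible (P.map Letter.mirror) := by
  obtain ⟨R, h1, h2⟩ := h
  exact ⟨_, h1.mirror, by simpa using h2⟩

end Reducible

/-! ### Relations between primes -/

theorem wordRel_three {C : Type} {p q r : Letter} {f g : ℤ → C} :
    wordRel [p, q, r] f g ↔ ∃ h k, p.Rel f h ∧ q.Rel h k ∧ r.Rel k g := by
  simp only [wordRel, exists_eq_right]; grind

theorem wordRel_two {C : Type} {p q : Letter} {f g : ℤ → C} :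
    wordRel [p, q] f g ↔ ∃ h, p.Rel f h ∧ q.Rel h g := by
  simp only [wordRel, exists_eq_right]

theorem wordRel_one {C : Type} {p : Letter} {f g : ℤ → C} :
    wordRel [p] f g ↔ p.Rel f g := by
  simp only [wordRel, exists_eq_right]

/-- The colouring which agrees with `f` outside the columns `i`, `i + 1`, `i + 2`, where its values
are `a`, `b`, `c`. -/
def recolor {C : Type} (f : ℤ → C) (i : ℤ) (a b c : C) : ℤ → C := fun k =>
  if k = i then a else if k = i + 1 then b else if k = i + 2 then c else f k

/-- The braid relation. -/
theorem simplifies_braid (i : ℤ) :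
    Simplifies [cross (i + 1), cross i, cross (i + 1)] [cross i, cross (i + 1), cross i] where
  length_le := le_rfl
  idx_mem := by simp [idx]
  rel C f g H := by
    rw [wordRel_three] at H ⊢
    obtain ⟨h, k, h1, h2, h3⟩ := H
    refine ⟨recolor f i (f i) (f (i + 2)) (f (i + 1)),
      recolor f i (f (i + 2)) (f i) (f (i + 1)), ?_⟩
    simp only [Letter.Rel, idx, recolor] at *
    grind

theorem simplifies_cross_hook_cross (i : ℤ) :
    Simplifies [cross (i + 1), hook i, cross (i + 1)] [cross i, hook (i + 1), cross i] where
  length_le := le_rfl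
  idx_mem := by simp [idx]
  rel C f g H := by
    rw [wordRel_three] at H ⊢
    obtain ⟨h, k, h1, h2, h3⟩ := H
    refine ⟨recolor f i (f i) (f (i + 2)) (f (i + 1)),
      recolor f i (g i) (g (i + 2)) (g (i + 1)), ?_⟩
    simp only [Letter.Rel, idx, recolor] at *
    grind

theorem simplifies_cross_cross_hook (i : ℤ) :
    Simplifies [cross (i + 1), cross i, hook (i + 1)] [hook i, hook (i + 1)] where
  length_le := by simp
  idx_mem := by simp [idx]
  rel C f g H := by
    rw [wordRel_three]
    rw [wordRel_two] at H
    obtain ⟨h, h1, h2⟩ := H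
    refine ⟨recolor f i (f i) (f (i + 2)) (f (i + 1)),
      recolor f i (f (i + 2)) (f i) (f (i + 1)), ?_⟩
    simp only [Letter.Rel, idx, recolor] at *
    grind

theorem simplifies_cross_hook_hook (i : ℤ) :
    Simplifies [cross (i + 1), hook i, hook (i + 1)] [cross i, hook (i + 1)] where
  length_le := by simp
  idx_mem := by simp [idx]
  rel C f g H := by
    rw [wordRel_three]
    rw [wordRel_two] at H
    obtain ⟨h, h1, h2⟩ := H
    refine ⟨recolor f i (f i) (f (i + 2)) (f (i + 1)),
      recolor f i (f (i + 1)) (f (i + 1)) (f (i + 1)), ?_⟩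
    simp only [Letter.Rel, idx, recolor] at *
    grind

theorem simplifies_hook_hook_hook (i : ℤ) :
    Simplifies [hook (i + 1), hook i, hook (i + 1)] [hook (i + 1)] where
  length_le := by simp
  idx_mem := by simp [idx]
  rel C f g H := by
    rw [wordRel_three]
    rw [wordRel_one] at H
    refine ⟨recolor f i (f i) (f i) (f i), recolor f i (f i) (f i) (f i), ?_⟩
    simp only [Letter.Rel, idx, recolor] at *
    grind

theorem simplifies_hook_cross_hook (i : ℤ) :
    Simplifies [hook (i + 1), cross i, hook (i + 1)] [hook (i + 1)] where
  length_le := by simp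
  idx_mem := by simp [idx]
  rel C f g H := by
    rw [wordRel_three]
    rw [wordRel_one] at H
    refine ⟨recolor f i (f i) (f i) (f i), recolor f i (f i) (f i) (f i), ?_⟩
    simp only [Letter.Rel, idx, recolor] at *
    grind

/-- Two letters in the same pair of columns simplify to a single letter or, if both are crossings,
to the empty word. -/
theorem exists_simplifies_pair {p r : Letter} (h : p.idx = r.idx) :
    ∃ Q, Simplifies [p, r] Q ∧ Q.length < 2 ∧ ∀ q ∈ Q, q.idx = p.idx := by
  have key : Simplifies [p, r] (match p, r with
      | cross _, cross _ => []
      | cross _, hook i => [hook i]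
      | hook i, cross _ => [hook i]
      | hook i, hook _ => [hook i]) := by
    rcases p with i | i <;> rcases r with j | j <;> simp only [idx] at h <;> subst h
    · refine ⟨by simp, by simp, fun C f g H => ?_⟩
      cases H
      rw [wordRel_two]
      refine ⟨recolor f i (f (i + 1)) (f i) (f (i + 2)), ?_⟩
      simp only [Letter.Rel, idx, recolor]
      grind
    all_goals
      refine ⟨by simp, by simp [idx], fun C f g H => ?_⟩
      rw [wordRel_one] at H
      rw [wordRel_two]
      first
        | exact ⟨f, by simp only [Letter.Rel, idx] at *; grind⟩
        | exact ⟨g, by simp only [Letter.Rel, idx] at *; grind⟩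
  refine ⟨_, key, ?_⟩
  cases p <;> cases r <;> simp_all

/-- A word `p q r` with `p`, `r` in columns `i + 1`, `i + 2` and `q` in columns `i`, `i + 1`
simplifies, to a strictly shorter word unless `p`, `r` are crossings; in that case the letters can
be rearranged so that crossings come first and last in columns `i`, `i + 1`. -/
theorem simplifies_triple {i : ℤ} {p q r : Letter} (hp : p.idx = i + 1) (hq : q.idx = i)
    (hr : r.idx = i + 1) :
    (∃ s : Letter, s.idx = i + 1 ∧ Simplifies [p, q, r] [cross i, s, cross i] ∧
      p = cross (i + 1)) ∨
    (∃ A s B, Simplifies [p, q, r] (A ++ s :: B) ∧ (A ++ s :: B).length < 3 ∧ s.idx = i + 1 ∧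
      (∀ a ∈ A, a.idx = i) ∧ ∀ b ∈ B, b.idx = i) := by
  rcases p with p | p <;> rcases q with q | q <;> rcases r with r | r <;>
    simp only [idx] at hp hq hr <;> subst p q r
  · exact .inl ⟨_, rfl, simplifies_braid i, rfl⟩
  · exact .inr ⟨[hook i], hook (i + 1), [], simplifies_cross_cross_hook i, by simp [idx]⟩
  · exact .inl ⟨_, rfl, simplifies_cross_hook_cross i, rfl⟩
  · exact .inr ⟨[cross i], hook (i + 1), [], simplifies_cross_hook_hook i, by simp [idx]⟩
  · exact .inr ⟨[], hook (i + 1), [hook i], (simplifies_cross_cross_hook i).reverse,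
      by simp [idx]⟩
  · exact .inr ⟨[], hook (i + 1), [], simplifies_hook_cross_hook i, by simp [idx]⟩
  · exact .inr ⟨[], hook (i + 1), [cross i], (simplifies_cross_hook_hook i).reverse,
      by simp [idx]⟩
  · exact .inr ⟨[], hook (i + 1), [], simplifies_hook_hook_hook i, by simp [idx]⟩

/-! ### Normal form and turning strands -/

/-- The word acts on columns up to `m + 1`, and at most one of its letters on column `m + 1`. -/
def AtMostOneTop (m : ℤ) (P : List Letter) : Prop :=
  (∀ p ∈ P, p.idx < m) ∨ ∃ A r B, P = A ++ r :: B ∧ r.idx = m ∧ (∀ a ∈ A, a.idx < m) ∧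
    ∀ b ∈ B, b.idx < m

/-- Every word has a normal form in which the highest column pair is used at most once: between two
such uses, the normal form of the intermediate word moves its lower letters out of the way, and
what remains is a triple to which `simplifies_triple` applies. -/
theorem exists_simplifies_atMostOneTop (n : ℕ) : ∀ (m : ℤ) (P : List Letter), P.length ≤ n →
    (∀ p ∈ P, p.idx ≤ m) → ∃ Q, Simplifies P Q ∧ AtMostOneTop m Q := by
  induction n with
  | zero =>
    intro m P hn _
    obtain rfl := List.length_eq_zero_iff.1 (Nat.le_zero.1 hn)
    exact ⟨[], .refl _, .inl (by simp)⟩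
  | succ n ih =>
    intro m P hn hm
    rcases P with _ | ⟨p, P⟩
    · exact ⟨[], .refl _, .inl (by simp)⟩
    obtain ⟨Q, hPQ, hQ⟩ := ih m P (by simpa using hn) fun q hq => hm q (by simp [hq])
    have hpQ : Simplifies (p :: P) (p :: Q) := (Simplifies.refl [p]).append hPQ
    have hpm := hm p (by simp)
    rcases hQ with hQ | ⟨A, r, B, rfl, hr, hA, hB⟩
    · refine ⟨_, hpQ, ?_⟩
      rcases hpm.lt_or_eq with hp | hp
      · exact .inl (by simpa [hp] using hQ)
      · exact .inr ⟨[], p, Q, rfl, hp, by simp, hQ⟩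
    rcases hpm.lt_or_eq with hp | hp
    · exact ⟨_, hpQ, .inr ⟨p :: A, r, B, rfl, hr, by simpa [hp] using hA, hB⟩⟩
    have hl : A.length ≤ n := by
      have := hPQ.length_le
      simp at this hn
      omega
    obtain ⟨A', hAA', hA'⟩ := ih (m - 1) A hl fun a ha => by have := hA a ha; omega
    rcases hA' with hA' | ⟨A₁, q, A₂, rfl, hq, hA₁, hA₂⟩
    · obtain ⟨Q, hQ, hQ2, hQp⟩ := exists_simplifies_pair (hp.trans hr.symm)
      refine ⟨A' ++ Q ++ B, hpQ.trans ?_, ?_⟩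
      · have h1 : Simplifies (p :: (A ++ r :: B)) ([p] ++ A' ++ r :: B) := by
          simpa using hAA'.congr [p] (r :: B)
        have h2 : Simplifies ([p] ++ A' ++ r :: B) (A' ++ [p] ++ r :: B) :=
          (Simplifies.cons_comm fun a ha => by have := hA' a ha; omega).append (.refl _)
        have h3 : Simplifies (A' ++ [p] ++ r :: B) (A' ++ Q ++ B) := by
          simpa using hQ.congr A' B
        exact (h1.trans h2).trans h3
      · have hA'' : ∀ a ∈ A', a.idx < m := fun a ha => by have := hA' a ha; omega
        match Q, hQ2, hQp with
        | [], _, _ => exact .inl (by simp; grind)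
        | [s], _, hs => exact .inr ⟨A', s, B, by simp, (hs s (by simp)).trans hp, hA'', hB⟩
    · have h1 : Simplifies (p :: (A ++ r :: B)) ([p] ++ A₁ ++ (q :: A₂ ++ r :: B)) := by
        simpa using hAA'.congr [p] (r :: B)
      have h2 : Simplifies ([p] ++ A₁ ++ (q :: A₂ ++ r :: B)) (A₁ ++ [p] ++ (q :: A₂ ++ r :: B)) :=
        (Simplifies.cons_comm fun a ha => by have := hA₁ a ha; omega).append (.refl _)
      have h3 : Simplifies (A₁ ++ [p] ++ (q :: A₂ ++ r :: B)) (A₁ ++ [p, q, r] ++ (A₂ ++ B)) := by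
        have := (Simplifies.comm_cons (P := A₂) (p := r) fun a ha => by
          have := hA₂ a ha; omega).congr (A₁ ++ [p, q]) B
        simpa using this
      have h := ((hpQ.trans h1).trans h2).trans h3
      rcases simplifies_triple (i := m - 1) (p := p) (by omega) hq (by omega : r.idx = m - 1 + 1) with
        ⟨s, hs, hsimp, -⟩ | ⟨X, s, Y, hsimp, -, hs, hX, hY⟩
      · refine ⟨_, h.trans (hsimp.congr _ _),
          .inr ⟨A₁ ++ [cross (m - 1)], s, cross (m - 1) :: (A₂ ++ B), by simp, by omega, ?_, ?_⟩⟩ <;>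
        · simp only [List.mem_append, List.mem_cons, List.not_mem_nil, or_false]
          rintro a (ha | ha | ha) <;> grind [idx]
      · refine ⟨_, h.trans (hsimp.congr _ _),
          .inr ⟨A₁ ++ X, s, Y ++ (A₂ ++ B), by simp, by omega, ?_, ?_⟩⟩ <;>
        · simp only [List.mem_append]
          grind

/-- The word `T_{i+1} T_{i+2} ⋯ T_{i+k}`. -/
def crossRun (i : ℤ) : ℕ → List Letter
  | 0 => []
  | k + 1 => crossRun i k ++ [cross (i + k + 1)]

theorem idx_mem_crossRun {i : ℤ} {k : ℕ} {p : Letter} (hp : p ∈ crossRun i k) :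
    i < p.idx ∧ p.idx ≤ i + k := by
  induction k with
  | zero => simp [crossRun] at hp
  | succ k ih =>
    rcases List.mem_append.1 hp with hp | hp
    · have := ih hp
      push_cast
      omega
    · obtain rfl := List.mem_singleton.1 hp
      simp only [idx]
      push_cast
      omega

/-- The strand which leaves the hook `U_i` at the lower right, runs to the right through `k`
crossings and turns back at the letter `p`. The word is reducible, by induction on `k`: after
normalizing the word `L`, the turn is either removed or moved back through the last crossing. -/
theorem reducible_hook_crossRun (k : ℕ) : ∀ (i : ℤ) (L : List Letter) (p : Letter),
    (∀ l ∈ L, l.idx < i + k) → p.idx = i + k → Reducible (hook i :: crossRun i k ++ L ++ [p]) := by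
  induction k with
  | zero =>
    intro i L p hL hp
    obtain ⟨L', hLL', hL'⟩ := exists_simplifies_atMostOneTop L.length (i - 1) L le_rfl
      fun l hl => by have := hL l hl; simp at this; omega
    simp only [Nat.cast_zero, add_zero, crossRun] at hL hp ⊢
    refine Reducible.of_simplifies (hLL'.congr [hook i] [p]) ?_
    rcases hL' with hL' | ⟨A, q, B, rfl, hq, hA, hB⟩
    · obtain ⟨Q, hQ, hQ2, -⟩ := exists_simplifies_pair (p := hook i) (r := p) hp.symm
      have h1 : Simplifies ([hook i] ++ L' ++ [p]) (L' ++ [hook i] ++ [p]) :=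
        (Simplifies.cons_comm fun a ha => by have := hL' a ha; simp only [idx_hook]; omega).append
          (.refl _)
      refine ⟨L' ++ Q, h1.trans ?_, by simp; omega⟩
      simpa using hQ.congr L' []
    · have h1 : Simplifies ([hook i] ++ (A ++ q :: B) ++ [p]) (A ++ [hook i] ++ (q :: B ++ [p])) := by
        simpa using (Simplifies.cons_comm (P := A) (p := hook i) fun a ha => by
          have := hA a ha; simp only [idx_hook]; omega).append (.refl (q :: B ++ [p]))
      have h2 : Simplifies (A ++ [hook i] ++ (q :: B ++ [p])) (A ++ [hook i, q, p] ++ B) := by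
        simpa using (Simplifies.comm_cons (P := B) (p := p) fun a ha => by
          have := hB a ha; omega).congr (A ++ [hook i, q]) []
      refine Reducible.of_simplifies (h1.trans h2) (Reducible.congr ?_ _ _)
      rcases simplifies_triple (i := i - 1) (p := hook i) (by simp [idx]) hq
        (by omega : p.idx = i - 1 + 1) with ⟨s, -, -, h⟩ | ⟨X, s, Y, hsimp, hlen, -⟩
      · simp at h
      · exact ⟨_, hsimp, hlen⟩
  | succ k ih =>
    intro i L p hL hp
    push_cast at hL hp
    obtain ⟨L', hLL', hL'⟩ := exists_simplifies_atMostOneTop L.length (i + k) L le_rfl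
      fun l hl => by have := hL l hl; omega
    refine Reducible.of_simplifies (hLL'.congr _ _) ?_
    simp only [crossRun]
    set c := cross (i + k + 1) with hc
    have hci : c.idx = i + k + 1 := rfl
    rcases hL' with hL' | ⟨A, q, B, rfl, hq, hA, hB⟩
    -- the last crossing meets `p`
    · obtain ⟨Q, hQ, hQ2, -⟩ := exists_simplifies_pair (p := c) (r := p) (by omega)
      have h1 : Simplifies (hook i :: (crossRun i k ++ [c]) ++ L' ++ [p])
          (hook i :: crossRun i k ++ L' ++ [c, p]) := by
        simpa using (Simplifies.cons_comm (P := L') (p := c) fun a ha => by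
          have := hL' a ha; omega).congr (hook i :: crossRun i k) [p]
      refine ⟨hook i :: crossRun i k ++ L' ++ Q, h1.trans ?_, by simp; omega⟩
      simpa using hQ.congr (hook i :: crossRun i k ++ L') []
    · have h1 : Simplifies (hook i :: (crossRun i k ++ [c]) ++ (A ++ q :: B) ++ [p])
          (hook i :: crossRun i k ++ A ++ [c] ++ (q :: B ++ [p])) := by
        simpa using (Simplifies.cons_comm (P := A) (p := c) fun a ha => by
          have := hA a ha; omega).congr (hook i :: crossRun i k) (q :: B ++ [p])
      have h2 : Simplifies (hook i :: crossRun i k ++ A ++ [c] ++ (q :: B ++ [p]))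
          (hook i :: crossRun i k ++ A ++ [c, q, p] ++ B) := by
        simpa using (Simplifies.comm_cons (P := B) (p := p) fun a ha => by
          have := hB a ha; omega).congr (hook i :: crossRun i k ++ A ++ [c, q]) []
      refine Reducible.of_simplifies (h1.trans h2) ?_
      rcases simplifies_triple (i := i + k) hci hq
        (by omega : p.idx = i + k + 1) with ⟨s, -, hsimp, -⟩ | ⟨X, s, Y, hsimp, hlen, -⟩
      -- the strand now turns back already at the crossing in columns `i + k` and `i + k + 1`
      · refine Reducible.of_simplifies (hsimp.congr _ _) ?_
        simpa using (ih i A (cross (i + k)) hA rfl).congr [] (s :: cross (i + k) :: B)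
      · exact Reducible.congr ⟨_, hsimp, hlen⟩ _ _

/-- The strand that enters the word from above in column `c` and is traced downwards runs
straight or crosses letters `T` from left to right, until it meets a letter that acts on the columns
`c' - 1` and `c'`, where `c'` is its current column. -/
inductive TurnsBack : ℤ → List Letter → Prop
  | turn {c : ℤ} {p : Letter} {F : List Letter} : p.idx = c - 1 → TurnsBack c (p :: F)
  | straight {c : ℤ} {p : Letter} {F : List Letter} : p.idx ≠ c → p.idx ≠ c - 1 → TurnsBack c F →
      TurnsBack c (p :: F)
  | cross {c : ℤ} {F : List Letter} : TurnsBack (c + 1) F → TurnsBack c (cross c :: F)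

/-- The letters read so far are kept in the form `U_i T_{i+1} ⋯ T_{i+k} L` with `L` to the left of
the strand, which is then in column `i + k + 1`. -/
theorem TurnsBack.reducible_aux {c : ℤ} {F : List Letter} (h : TurnsBack c F) :
    ∀ (i : ℤ) (k : ℕ) (L : List Letter), c = i + k + 1 → (∀ l ∈ L, l.idx < i + k) →
      Reducible (hook i :: crossRun i k ++ L ++ F) := by
  induction h with
  | @turn c p F hp =>
    intro i k L hc hL
    simpa using (reducible_hook_crossRun k i L p hL (by omega)).congr [] F
  | @straight c p F h1 h2 _ ih =>
    intro i k L hc hL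
    rcases lt_or_gt_of_ne h1 with h | h
    · simpa using ih i k (L ++ [p]) hc (by
        simp only [List.mem_append, List.mem_singleton]
        rintro l (hl | rfl)
        · exact hL l hl
        · omega)
    · have hs : Simplifies ((hook i :: crossRun i k ++ L) ++ [p] ++ F)
          ((p :: (hook i :: crossRun i k ++ L)) ++ F) := by
        refine (Simplifies.comm_cons fun q hq => ?_).append (.refl _)
        simp only [List.cons_append, List.mem_cons, List.mem_append] at hq
        rcases hq with rfl | hq | hq
        · simp only [idx_hook]; omega
        · have := idx_mem_crossRun hq; omega
        · have := hL q hq; omega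
      have := Reducible.of_simplifies hs (by simpa using (ih i k L hc hL).congr [p] [])
      simpa using this
  | @cross c F _ ih =>
    intro i k L hc hL
    have hs : Simplifies ((hook i :: crossRun i k) ++ (L ++ [Letter.cross c]) ++ F)
        ((hook i :: crossRun i k) ++ (Letter.cross c :: L) ++ F) :=
      (Simplifies.comm_cons fun q hq => by have := hL q hq; simp only [idx_cross]; omega).congr _ _
    have := ih i (k + 1) L (by push_cast; omega) fun l hl => by
      have := hL l hl; push_cast; omega
    refine Reducible.of_simplifies (P := hook i :: crossRun i k ++ L ++ Letter.cross c :: F)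
      (by simpa using hs) ?_
    subst hc
    simpa [crossRun] using this

/-- A word is reducible if a strand leaves a hook to the right and later turns back. -/
theorem TurnsBack.reducible {i : ℤ} {F : List Letter} (h : TurnsBack (i + 1) F) :
    Reducible (hook i :: F) := by
  simpa [crossRun] using h.reducible_aux i 0 [] (by simp) (by simp)

variable {N : ℕ}

/-! ### Factorizations of tangles as words -/

/-- The letter with integer columns that corresponds to a prime tangle. -/
def PrimeTangle.letter : PrimeTangle N → Letter
  | T i _ => cross i
  | U i _ => hook i

theorem PrimeTangle.idx_letter (p : PrimeTangle N) : p.letter.idx = (p.left : ℕ) := by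
  cases p <;> rfl

theorem PrimeTangle.coe_right (p : PrimeTangle N) : (p.right : ℕ) = p.left + 1 := by
  cases p <;> rfl

/-- The colour of a node if the upper row is coloured by `f` and the lower row by `g`. -/
def Node.color {C : Type} (f g : ℤ → C) : Node N → C
  | Sum.inl k => f (k : ℕ)
  | Sum.inr k => g (k : ℕ)

theorem PrimeTangle.letter_rel_iff {C : Type} (p : PrimeTangle N) (f g : ℤ → C) :
    p.letter.Rel f g ↔
      (∀ q : Node N, q.color f g = (p.toTangle.partner q).color f g) ∧
        ∀ k : ℤ, k < 0 ∨ N ≤ k → f k = g k := by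
  rcases p with ⟨i, h⟩ | ⟨i, h⟩
  · constructor
    · rintro ⟨h1, h2, h3⟩
      refine ⟨?_, fun k hk => h1 k ?_ ?_⟩
      · rintro (k | k) <;>
          simp only [toTangle, crossTangle, Node.color, Equiv.swap_apply_def, left, right,
            Fin.ext_iff, letter, idx] at * <;> grind
      all_goals simp only [letter, idx]; omega
    · rintro ⟨h1, h2⟩
      have e1 := h1 (Sum.inl ⟨i, by omega⟩)
      have e2 := h1 (Sum.inl ⟨i + 1, by omega⟩)
      simp only [toTangle, crossTangle, Node.color, Equiv.swap_apply_def, left, right,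
            Fin.ext_iff] at e1 e2
      refine ⟨fun k hk hk' => ?_, by simpa using e1, by simpa using e2⟩
      by_cases hkN : k < 0 ∨ N ≤ k
      · exact h2 k hkN
      · push Not at hkN
        have := h1 (Sum.inl ⟨k.toNat, by omega⟩)
        simp only [toTangle, crossTangle, Node.color, Equiv.swap_apply_def, left, right,
            Fin.ext_iff, letter, idx] at this hk hk'
        rw [if_neg (by omega), if_neg (by omega)] at this
        simpa [hkN.1] using this
  · constructor
    · rintro ⟨h1, h2, h3⟩
      refine ⟨?_, fun k hk => h1 k ?_ ?_⟩
      · rintro (k | k) <;>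
          simp only [toTangle, hookTangle, Node.color, left, right,
            Fin.ext_iff, letter, idx] at * <;> grind [Node.color]
      all_goals simp only [letter, idx]; omega
    · rintro ⟨h1, h2⟩
      have e1 := h1 (Sum.inl ⟨i, by omega⟩)
      have e2 := h1 (Sum.inr ⟨i, by omega⟩)
      simp only [toTangle, hookTangle, Node.color, left, right, Fin.ext_iff] at e1 e2
      refine ⟨fun k hk hk' => ?_, by simpa using e1, by simpa using e2⟩
      by_cases hkN : k < 0 ∨ N ≤ k
      · exact h2 k hkN
      · push Not at hkN
        have := h1 (Sum.inl ⟨k.toNat, by omega⟩)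
        simp only [toTangle, hookTangle, Node.color, left, right,
            Fin.ext_iff, letter, idx] at this hk hk'
        rw [if_neg (by omega), if_neg (by omega)] at this
        simpa [Node.color, hkN.1] using this

theorem wordRel_iff_exists {C : Type} (P : List Letter) (f g : ℤ → C) :
    wordRel P f g ↔ ∃ h : ℕ → ℤ → C, h 0 = f ∧ h P.length = g ∧
      ∀ j (hj : j < P.length), P[j].Rel (h j) (h (j + 1)) := by
  induction P generalizing f with
  | nil =>
    constructor
    · rintro rfl
      exact ⟨fun _ => f, rfl, rfl, by simp⟩
    · rintro ⟨h, rfl, rfl, -⟩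
      rfl
  | cons p P ih =>
    constructor
    · rintro ⟨e, h1, h2⟩
      obtain ⟨h, h0, hl, hs⟩ := (ih e).1 h2
      refine ⟨fun n => Nat.casesOn n f h, rfl, hl, ?_⟩
      rintro (_ | j) hj
      · simpa [h0] using h1
      · simpa using hs j (by simpa using hj)
    · rintro ⟨h, rfl, hl, hs⟩
      refine ⟨h 1, hs 0 (by simp), (ih _).2 ⟨fun n => h (n + 1), rfl, hl, ?_⟩⟩
      intro j hj
      exact hs (j + 1) (by simpa using hj)

/-- A word composes to `X` if and only if any two colourings of the outer rows that are related by
the word are constant on the edges of `X`. For the converse direction, the points of the stack are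
coloured by whether they are connected to a given outer node. -/
theorem isFactorization_iff (F : List (PrimeTangle N)) (X : Tangle N) :
    IsFactorization F X ↔ ∀ f g : ℤ → Prop, wordRel (F.map PrimeTangle.letter) f g →
      ∀ u : Node N, u.color f g = (X.partner u).color f g := by
  constructor
  · intro hX f g hfg u
    obtain ⟨h, rfl, rfl, hs⟩ := (wordRel_iff_exists _ _ _).1 hfg
    have hadj : ∀ a b, (stack (layers F)).Adj a b →
        h (a.1 : ℕ) (a.2 : ℕ) = h (b.1 : ℕ) (b.2 : ℕ) := by
      rintro _ _ ⟨j, p, rfl, rfl⟩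
      have hj := hs j (by simp)
      rw [List.getElem_map, PrimeTangle.letter_rel_iff] at hj
      have key : ∀ q : Node N, h ((place j q).1 : ℕ) ((place j q).2 : ℕ)
          = q.color (h j) (h (j + 1)) := by rintro (k | k) <;> rfl
      rw [key, key]
      exact hj.1 p
    have hreach : ∀ a b, (stack (layers F)).Reachable a b →
        h (a.1 : ℕ) (a.2 : ℕ) = h (b.1 : ℕ) (b.2 : ℕ) := by
      rintro a b ⟨w⟩
      induction w with
      | nil => rfl
      | cons hab _ ih => exact (hadj _ _ hab).trans ih
    have key : ∀ q : Node N, h ((outer F.length q).1 : ℕ) ((outer F.length q).2 : ℕ)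
        = q.color (h 0) (h (F.map PrimeTangle.letter).length) := by
      rintro (k | k) <;> simp [outer, Node.color]
    rw [← key, ← key]
    exact hreach _ _ (hX u)
  · intro H u
    let h : ℕ → ℤ → Prop := fun r k => ∃ (hr : r < F.length + 1) (c : Fin N), (c : ℕ) = k ∧
      (stack (layers F)).Reachable (outer F.length u) (⟨r, hr⟩, c)
    have hh : ∀ a : Fin (F.length + 1) × Fin N, h (a.1 : ℕ) (a.2 : ℕ) ↔
        (stack (layers F)).Reachable (outer F.length u) a := by
      rintro ⟨r, k⟩
      constructor
      · rintro ⟨hr, c, hc, hreach⟩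
        have : c = k := by ext; exact_mod_cast hc
        subst this
        exact hreach
      · intro hreach
        exact ⟨r.2, k, rfl, hreach⟩
    have key : ∀ q : Node N, h ((outer F.length q).1 : ℕ) ((outer F.length q).2 : ℕ)
        = q.color (h 0) (h (F.map PrimeTangle.letter).length) := by
      rintro (k | k) <;> simp [outer, Node.color]
    have hrel : wordRel (F.map PrimeTangle.letter) (h 0)
        (h (F.map PrimeTangle.letter).length) := by
      refine (wordRel_iff_exists _ _ _).2 ⟨h, rfl, rfl, fun j hj => ?_⟩
      rw [List.getElem_map, PrimeTangle.letter_rel_iff]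
      rw [List.length_map] at hj
      refine ⟨fun q => ?_, fun k hk => ?_⟩
      · have key' : ∀ q : Node N, q.color (h j) (h (j + 1))
            = h ((place (⟨j, hj⟩ : Fin F.length) q).1 : ℕ)
              ((place (⟨j, hj⟩ : Fin F.length) q).2 : ℕ) := by rintro (k | k) <;> rfl
        have hadj : (stack (layers F)).Adj (place ⟨j, hj⟩ q)
            (place ⟨j, hj⟩ ((layers F ⟨j, hj⟩).partner q)) := ⟨_, q, rfl, rfl⟩
        rw [key', key']
        refine propext ((hh _).trans (Iff.trans ?_ (hh _).symm))
        exact ⟨fun hr => hr.trans hadj.reachable, fun hr => hr.trans hadj.symm.reachable⟩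
      · refine propext (iff_of_false ?_ ?_) <;>
        · rintro ⟨_, c, hc, -⟩
          have := c.2
          omega
    have := H _ _ hrel u
    rw [← key, ← key] at this
    rw [← hh, ← this, hh]

theorem exists_map_letter {P : List Letter}
    (h : ∀ p ∈ P, 0 ≤ p.idx ∧ p.idx + 1 < N) :
    ∃ F : List (PrimeTangle N), F.map PrimeTangle.letter = P := by
  induction P with
  | nil => exact ⟨[], rfl⟩
  | cons p P ih =>
    obtain ⟨F, rfl⟩ := ih fun q hq => h q (by simp [hq])
    obtain ⟨h0, hN⟩ := h p (by simp)
    rcases p with i | i <;> simp only [idx] at h0 hN <;> lift i to ℕ using h0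
    · exact ⟨.T i (by omega) :: F, rfl⟩
    · exact ⟨.U i (by omega) :: F, rfl⟩

theorem IsMinimalFactorization.not_reducible {X : Tangle N} {F : List (PrimeTangle N)}
    (hF : IsMinimalFactorization F X) : ¬ Reducible (F.map PrimeTangle.letter) := by
  rintro ⟨Q, hQ, hlt⟩
  obtain ⟨F', rfl⟩ := exists_map_letter (N := N) (P := Q) fun q hq => by
    obtain ⟨p, hp, e⟩ := hQ.idx_mem q hq
    obtain ⟨p, -, rfl⟩ := List.mem_map.1 hp
    rw [e, p.idx_letter]
    have := p.coe_right
    have := p.right.2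
    omega
  have := hF.2 F' ((isFactorization_iff _ _).2 fun f g h =>
    (isFactorization_iff _ _).1 hF.1 f g (hQ.rel _ f g h))
  simp only [List.length_map] at hlt
  omega

/-! ### Edges of a prime -/

namespace PrimeTangle

/-- The signed horizontal displacement along the edge of the prime that starts at the node `q`. -/
def shift (p : PrimeTangle N) (q : Node N) : ℤ :=
  (((p.toTangle.partner q).col : ℕ) : ℤ) - ((q.col : ℕ) : ℤ)

/-- An edge of a prime is vertical, or an edge of a crossing, or an edge of a hook. -/
theorem edge_cases (p : PrimeTangle N) (q : Node N) :
    (p.shift q = 0 ∧ (p.toTangle.partner q).isLeft = !q.isLeft ∧ ((q.col : ℕ) : ℤ) ≠ p.letter.idx ∧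
      ((q.col : ℕ) : ℤ) ≠ p.letter.idx + 1) ∨
    (((q.col : ℕ) : ℤ) = p.letter.idx ∧ p.shift q = 1 ∨
      ((q.col : ℕ) : ℤ) = p.letter.idx + 1 ∧ p.shift q = -1) ∧
    ((p.toTangle.partner q).isLeft = !q.isLeft ∧ p.letter = cross p.letter.idx ∨
      (p.toTangle.partner q).isLeft = q.isLeft ∧ p.letter = hook p.letter.idx ∧ p.IsU) := by
  rcases p with ⟨i, h⟩ | ⟨i, h⟩ <;> rcases q with k | k <;>
    simp only [shift, toTangle, crossTangle, hookTangle, Equiv.swap_apply_def, left, right,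
      Fin.ext_iff, letter, idx, Node.col, IsU] <;> grind [Node.col]

theorem shift_partner (p : PrimeTangle N) (q : Node N) :
    p.shift (p.toTangle.partner q) = -p.shift q := by
  simp [shift, p.toTangle.partner_partner]

end PrimeTangle

/-! ### Steps of strands in a stacked diagram -/

section Trace

variable {n : ℕ}

/-- A step of a strand in a stack: the layer and the node of this layer at which the step starts.
The step `s` is directly followed by the step `t`. -/
def FollowedBy (L : Fin n → Tangle N) (s t : Fin n × Node N) : Prop :=
  place s.1 ((L s.1).partner s.2) = place t.1 t.2 ∧ s.1 ≠ t.1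

/-- The step in the opposite direction. -/
def backStep (L : Fin n → Tangle N) (s : Fin n × Node N) : Fin n × Node N :=
  (s.1, (L s.1).partner s.2)

theorem FollowedBy.back {L : Fin n → Tangle N} {s t : Fin n × Node N} (h : FollowedBy L s t) :
    FollowedBy L (backStep L t) (backStep L s) :=
  ⟨by simpa [backStep, (L t.1).partner_partner] using h.1.symm, h.2.symm⟩

theorem place_eq_place {j j' : Fin n} {p p' : Node N} (h : place j p = place j' p')
    (hj : j ≠ j') : p.col = p'.col ∧
      (p.isLeft = false ∧ p'.isLeft = true ∧ (j : ℕ) + 1 = j' ∨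
        p.isLeft = true ∧ p'.isLeft = false ∧ (j' : ℕ) + 1 = j) := by
  rcases p with k | k <;> rcases p' with k' | k' <;>
    simp only [place, Prod.mk.injEq, Fin.ext_iff, Fin.val_castSucc, Fin.val_succ, Node.col,
      Sum.isLeft, ne_eq] at * <;> grind

/-- A point of the stack belongs to at most two layers. -/
theorem eq_or_eq_of_place {j₁ j₂ j : Fin n} {p₁ p₂ p : Node N} (h₁ : place j p = place j₁ p₁)
    (h₂ : place j p = place j₂ p₂) (hne : j₁ ≠ j₂) : j = j₁ ∨ j = j₂ := by
  by_contra! h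
  have e₁ := place_eq_place h₁ h.1
  have e₂ := place_eq_place h₂ h.2
  grind

/-- An outer point of the stack belongs to only one layer. -/
theorem eq_of_place_eq_outer {j j' : Fin n} {p p' u : Node N} (h : place j p = outer n u)
    (h' : place j' p' = outer n u) : j = j' := by
  rcases p with k | k <;> rcases p' with k' | k' <;> rcases u with l | l <;>
    simp only [place, outer, Prod.mk.injEq, Fin.ext_iff, Fin.val_castSucc, Fin.val_succ,
      Fin.val_last, Fin.val_zero] at * <;> omega

end Trace

section Ahead

variable (F : List (PrimeTangle N))

/-- The signed horizontal displacement of a step. -/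
def stepShift (s : Fin F.length × Node N) : ℤ := (F.get s.1).shift s.2

/-- The column in which a step starts. -/
def stepCol (s : Fin F.length × Node N) : ℤ := (s.2.col : ℕ)

/-- The letters that a strand meets from the given step on, as long as it does not change its
vertical direction. -/
def ahead (s : Fin F.length × Node N) : List Letter :=
  if s.2.isLeft then (F.map PrimeTangle.letter).drop s.1
  else ((F.map PrimeTangle.letter).take (s.1 + 1)).reverse

variable {F}

theorem ahead_eq_cons (s : Fin F.length × Node N) :
    ahead F s = (F.get s.1).letter :: (ahead F s).tail := by
  obtain ⟨j, p⟩ := s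
  unfold ahead
  dsimp only
  split_ifs
  · rw [List.drop_eq_getElem_cons (by simp)]
    simp
  · rw [List.take_add_one, List.getElem?_eq_getElem (by simp)]
    simp

theorem FollowedBy.stepCol_eq {s t : Fin F.length × Node N} (h : FollowedBy (layers F) s t) :
    stepCol F t = stepCol F s + stepShift F s := by
  have := (place_eq_place h.1 h.2).1
  simp only [stepCol, stepShift, PrimeTangle.shift, layers] at *
  rw [← this]
  ring

/-- A step from one row of its layer to the other keeps the vertical direction, so only its own
letter is removed from the letters ahead. -/
theorem FollowedBy.ahead_eq {s t : Fin F.length × Node N} (h : FollowedBy (layers F) s t)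
    (hs : ((F.get s.1).toTangle.partner s.2).isLeft = !s.2.isLeft) :
    ahead F s = (F.get s.1).letter :: ahead F t := by
  have h1 := (place_eq_place h.1 h.2).2
  simp only [layers] at h1
  rw [hs] at h1
  obtain ⟨j, p⟩ := s
  obtain ⟨j', p'⟩ := t
  unfold ahead
  dsimp only at *
  rcases h1 with ⟨h1, h2, h3⟩ | ⟨h1, h2, h3⟩
  · have h4 : p.isLeft = true := by simpa using h1
    rw [if_pos h4, if_pos h2, List.drop_eq_getElem_cons (by simp), h3]
    simp
  · have h4 : ¬ p.isLeft = true := by simpa using h1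
    rw [if_neg h4, if_neg (by simp [h2]), List.take_add_one, List.getElem?_eq_getElem (by simp), h3]
    simp

/-- A strand that is turned around by a hook meets afterwards the part of the word, or of the
reversed word, that follows the hook. -/
theorem FollowedBy.exists_append_ahead {s t : Fin F.length × Node N}
    (h : FollowedBy (layers F) s t)
    (hs : ((F.get s.1).toTangle.partner s.2).isLeft = s.2.isLeft) :
    ∃ A, A ++ (F.get s.1).letter :: ahead F t = F.map PrimeTangle.letter ∨
      A ++ (F.get s.1).letter :: ahead F t = (F.map PrimeTangle.letter).reverse := by
  have h1 := (place_eq_place h.1 h.2).2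
  simp only [layers] at h1
  rw [hs] at h1
  obtain ⟨j, p⟩ := s
  obtain ⟨j', p'⟩ := t
  unfold ahead
  dsimp only at *
  rcases h1 with ⟨h1, h2, h3⟩ | ⟨h1, h2, h3⟩
  · refine ⟨(F.map PrimeTangle.letter).take j, .inl ?_⟩
    rw [if_pos h2, ← h3]
    conv_rhs => rw [← List.take_append_drop j (F.map PrimeTangle.letter),
      List.drop_eq_getElem_cons (by simp)]
    simp
  · refine ⟨((F.map PrimeTangle.letter).drop (j + 1)).reverse, .inr ?_⟩
    rw [if_neg (by simp [h2]), h3]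
    conv_rhs => rw [← List.take_append_drop (j + 1) (F.map PrimeTangle.letter),
      List.reverse_append, List.take_add_one, List.getElem?_eq_getElem (by simp)]
    simp

variable {s : ℕ → Fin F.length × Node N} {a b : ℕ}

/-- The step `s` runs along a hook, that is, it starts and ends in the same row of its layer. -/
def IsHookStep (s : Fin F.length × Node N) : Prop :=
  ((F.get s.1).toTangle.partner s.2).isLeft = s.2.isLeft

theorem turnsBack_right (hab : ∀ k, a < k → k < b → FollowedBy (layers F) (s k) (s (k + 1)))
    (hb : stepShift F (s b) = -1)
    (hk : ∀ k, a < k → k < b → stepShift F (s k) ≠ -1 ∧ ¬ IsHookStep (s k)) (d : ℕ) :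
    ∀ k, a < k → k + d = b → TurnsBack (stepCol F (s k)) (ahead F (s k)) := by
  induction d with
  | zero =>
    rintro k hak rfl
    rw [ahead_eq_cons]
    refine .turn ?_
    have := (F.get (s k).1).edge_cases (s k).2
    simp only [stepShift, add_zero] at hb
    simp only [stepCol]
    omega
  | succ d ih =>
    intro k hak hkb
    have hF := hab k hak (by omega)
    obtain ⟨h1, h2⟩ := hk k hak (by omega)
    have ih := ih (k + 1) (by omega) (by omega)
    rw [hF.stepCol_eq] at ih
    simp only [stepShift, IsHookStep] at h1 h2 ih
    rcases (F.get (s k).1).edge_cases (s k).2 with ⟨e1, e2, e3, e4⟩ | ⟨⟨e1, e2⟩ | ⟨-, e2⟩, e3⟩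
    · rw [e1, add_zero] at ih
      rw [hF.ahead_eq e2]
      exact .straight e3.symm (fun h => e4 (by simp only [stepCol] at h; omega)) ih
    · rcases e3 with ⟨e3, e4⟩ | ⟨e3, -⟩
      · rw [hF.ahead_eq e3, e4, ← e1]
        rw [e2] at ih
        exact .cross ih
      · exact absurd e3 h2
    · exact absurd e2 h1

theorem turnsBack_left (hab : ∀ k, a < k → k < b → FollowedBy (layers F) (s k) (s (k + 1)))
    (hb : stepShift F (s b) = 1)
    (hk : ∀ k, a < k → k < b → stepShift F (s k) ≠ 1 ∧ ¬ IsHookStep (s k)) (d : ℕ) :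
    ∀ k, a < k → k + d = b →
      TurnsBack (-stepCol F (s k)) ((ahead F (s k)).map Letter.mirror) := by
  induction d with
  | zero =>
    rintro k hak rfl
    rw [ahead_eq_cons]
    refine .turn ?_
    have := (F.get (s k).1).edge_cases (s k).2
    simp only [stepShift, add_zero] at hb
    simp only [stepCol, idx_mirror]
    omega
  | succ d ih =>
    intro k hak hkb
    have hF := hab k hak (by omega)
    obtain ⟨h1, h2⟩ := hk k hak (by omega)
    have ih := ih (k + 1) (by omega) (by omega)
    rw [hF.stepCol_eq] at ih
    simp only [stepShift, IsHookStep] at h1 h2 ih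
    rcases (F.get (s k).1).edge_cases (s k).2 with ⟨e1, e2, e3, e4⟩ | ⟨⟨-, e2⟩ | ⟨e1, e2⟩, e3⟩
    · rw [e1, add_zero] at ih
      rw [hF.ahead_eq e2]
      refine .straight ?_ ?_ ih <;> simp only [stepCol, idx_mirror] <;> omega
    · exact absurd e2 h1
    · rcases e3 with ⟨e3, e4⟩ | ⟨e3, -⟩
      · have e5 : (cross (F.get (s k).1).letter.idx).mirror = cross (-stepCol F (s k)) := by
          simp only [Letter.mirror, stepCol, e1]
          congr 1
          ring
        rw [hF.ahead_eq e3, List.map_cons, e4, e5]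
        rw [e2, neg_add, neg_neg] at ih
        exact .cross ih
      · exact absurd e3 h2

/-- If a strand runs along a hook, then through crossings without changing its horizontal
direction, and then changes its horizontal direction, the word is reducible. -/
theorem reducible_of_turn (hlt : a < b)
    (hab : ∀ k, a ≤ k → k < b → FollowedBy (layers F) (s k) (s (k + 1)))
    (ha : IsHookStep (s a)) (hb : stepShift F (s b) = -stepShift F (s a))
    (hk : ∀ k, a < k → k < b → stepShift F (s k) ≠ -stepShift F (s a) ∧ ¬ IsHookStep (s k)) :
    Reducible (F.map PrimeTangle.letter) := by
  obtain ⟨A, hA⟩ := (hab a le_rfl hlt).exists_append_ahead ha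
  suffices h : Reducible ((F.get (s a).1).letter :: ahead F (s (a + 1))) by
    have := h.congr A []
    rw [List.append_nil] at this
    rcases hA with hA | hA <;> rw [hA] at this
    · exact this
    · simpa using this.reverse
  have hc := (hab a le_rfl hlt).stepCol_eq
  rcases (F.get (s a).1).edge_cases (s a).2 with ⟨-, e, -⟩ | ⟨e, e'⟩
  · exact absurd (e.symm.trans ha) (Bool.not_ne_self _)
  have e4 : (F.get (s a).1).letter = hook (F.get (s a).1).letter.idx := by
    rcases e' with ⟨e', -⟩ | ⟨-, e', -⟩
    · exact absurd (e'.symm.trans ha) (Bool.not_ne_self _)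
    · exact e'
  simp only [IsHookStep, stepShift] at hc hb hk ha
  rcases e with ⟨e1, e2⟩ | ⟨e1, e2⟩ <;> simp only [e2, neg_neg] at hb hk hc
  · have := turnsBack_right (a := a) (fun k h => hab k h.le) hb hk (b - (a + 1)) (a + 1)
      (by omega) (by omega)
    rw [e4]
    refine TurnsBack.reducible ?_
    rw [hc, stepCol, e1] at this
    exact this
  · have := turnsBack_left (a := a) (fun k h => hab k h.le) hb hk (b - (a + 1)) (a + 1)
      (by omega) (by omega)
    have h2 : Reducible (hook (-(F.get (s a).1).letter.idx - 1) ::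
        (ahead F (s (a + 1))).map Letter.mirror) := by
      refine TurnsBack.reducible ?_
      rw [hc, stepCol, e1] at this
      convert this using 1
      ring
    have h3 := h2.mirror
    rw [List.map_cons, Letter.map_mirror_map_mirror] at h3
    rw [e4]
    simpa [Letter.mirror] using h3

theorem stepShift_of_isHookStep {t : Fin F.length × Node N} (h : IsHookStep t) :
    stepShift F t = 1 ∨ stepShift F t = -1 := by
  have := (F.get t.1).edge_cases t.2
  simp only [IsHookStep, stepShift] at *
  grind

theorem reducible_of_hook_of_turn_after (d : ℕ) : ∀ a b, a + d = b → a < b →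
    (∀ k, a ≤ k → k < b → FollowedBy (layers F) (s k) (s (k + 1))) →
    IsHookStep (s a) → stepShift F (s b) = -stepShift F (s a) →
    Reducible (F.map PrimeTangle.letter) := by
  induction d using Nat.strong_induction_on with
  | _ d ih =>
    intro a b hd hlt hab ha hb
    by_cases h1 : ∃ k, a < k ∧ k < b ∧ stepShift F (s k) = -stepShift F (s a)
    · obtain ⟨k, hak, hkb, hk⟩ := h1
      exact ih (k - a) (by omega) a k (by omega) hak (fun m h h' => hab m h (by omega)) ha hk
    by_cases h2 : ∃ k, a < k ∧ k < b ∧ IsHookStep (s k)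
    · obtain ⟨k, hak, hkb, hk⟩ := h2
      refine ih (b - k) (by omega) k b (by omega) hkb (fun m h => hab m (by omega)) hk ?_
      have e1 := stepShift_of_isHookStep hk
      have e2 := stepShift_of_isHookStep ha
      have e3 : ¬ stepShift F (s k) = -stepShift F (s a) := fun h => h1 ⟨k, hak, hkb, h⟩
      omega
    · exact reducible_of_turn hlt hab ha hb fun k hak hkb =>
        ⟨fun h => h1 ⟨k, hak, hkb, h⟩, fun h => h2 ⟨k, hak, hkb, h⟩⟩

theorem stepShift_backStep (t : Fin F.length × Node N) :
    stepShift F (backStep (layers F) t) = -stepShift F t :=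
  (F.get t.1).shift_partner t.2

theorem IsHookStep.back {t : Fin F.length × Node N} (h : IsHookStep t) :
    IsHookStep (backStep (layers F) t) := by
  simp only [IsHookStep, backStep, layers, Tangle.partner_partner] at *
  exact h.symm

/-- A strand that runs along a hook and takes two steps in opposite horizontal directions makes the
word reducible. -/
theorem reducible_of_hook {m k₁ k₂ k₃ : ℕ}
    (hs : ∀ k, k + 1 < m → FollowedBy (layers F) (s k) (s (k + 1)))
    (h₁ : k₁ < m) (h₂ : k₂ < m) (h₃ : k₃ < m) (hook : IsHookStep (s k₁))
    (hne : stepShift F (s k₂) ≠ 0) (hneg : stepShift F (s k₃) = -stepShift F (s k₂)) :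
    Reducible (F.map PrimeTangle.letter) := by
  have e1 := stepShift_of_isHookStep hook
  have e2 : stepShift F (s k₂) = 1 ∨ stepShift F (s k₂) = -1 := by
    have := (F.get (s k₂).1).edge_cases (s k₂).2
    simp only [stepShift] at *
    grind
  obtain ⟨b, hbm, hb⟩ : ∃ b < m, stepShift F (s b) = -stepShift F (s k₁) := by
    by_cases h : stepShift F (s k₂) = -stepShift F (s k₁)
    · exact ⟨k₂, h₂, h⟩
    · exact ⟨k₃, h₃, by omega⟩
  rcases lt_trichotomy k₁ b with h | rfl | h
  · exact reducible_of_hook_of_turn_after (s := s) (b - k₁) k₁ b (by omega) h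
      (fun k _ _ => hs k (by omega)) hook hb
  · omega
  -- the turn precedes the hook: trace the strand in the opposite direction
  · refine reducible_of_hook_of_turn_after (s := fun k => backStep (layers F) (s (k₁ + b - k)))
      (k₁ - b) b k₁ (by omega) h (fun k h1 h2 => ?_) ?_ ?_
    · have := (hs (k₁ + b - (k + 1)) (by omega)).back
      rwa [show k₁ + b - (k + 1) + 1 = k₁ + b - k by omega] at this
    · simpa using hook.back
    · simp only [stepShift_backStep, Nat.add_sub_cancel, Nat.add_sub_cancel_left]
      omega

end Ahead

/-! ### The path of an edge -/

variable {F : List (PrimeTangle N)} {u v : Node N}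

/-- The points `pt 0, …, pt m` form a path in the stacked diagram of `F` from the outer node `u` to
the outer node `v`, whose successive steps are `s 0, …, s (m - 1)`. -/
structure IsTrace (F : List (PrimeTangle N)) (u v : Node N) (m : ℕ)
    (pt : ℕ → Fin (F.length + 1) × Fin N) (s : ℕ → Fin F.length × Node N) : Prop where
  pos : 0 < m
  pt_zero : pt 0 = outer F.length u
  pt_end : pt m = outer F.length v
  pt_eq : ∀ k < m, pt k = place (s k).1 (s k).2
  pt_succ : ∀ k < m, pt (k + 1) = place (s k).1 ((layers F (s k).1).partner (s k).2)
  followedBy : ∀ k, k + 1 < m → FollowedBy (layers F) (s k) (s (k + 1))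

theorem outer_injective {n : ℕ} (hn : 0 < n) : Function.Injective (outer n (N := N)) := by
  rintro (k | k) (l | l) h <;> simp_all [outer, Fin.ext_iff]

theorem SimpleGraph.Walk.IsPath.exists_isTrace (hF : F ≠ []) (huv : u ≠ v)
    {w : (stack (layers F)).Walk (outer F.length u) (outer F.length v)} (hw : w.IsPath) :
    ∃ s, IsTrace F u v w.length w.getVert s := by
  have hn : 0 < F.length := List.length_pos_iff.2 hF
  have : ∀ k, ∃ s : Fin F.length × Node N, k < w.length → w.getVert k = place s.1 s.2 ∧
      w.getVert (k + 1) = place s.1 ((layers F s.1).partner s.2) := by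
    intro k
    by_cases hk : k < w.length
    · obtain ⟨j, p, h1, h2⟩ := w.adj_getVert_succ hk
      exact ⟨(j, p), fun _ => ⟨h1, h2⟩⟩
    · exact ⟨(⟨0, hn⟩, u), fun h => absurd h hk⟩
  choose s hs using this
  refine ⟨s, ⟨?_, w.getVert_zero, w.getVert_length, fun k hk => (hs k hk).1,
    fun k hk => (hs k hk).2, fun k hk => ?_⟩⟩
  · rw [Nat.pos_iff_ne_zero]
    exact fun h => huv (outer_injective hn (SimpleGraph.Walk.eq_of_length_eq_zero h))
  · have e1 := (hs k (by omega)).2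
    have e2 := hs (k + 1) hk
    refine ⟨e1.symm.trans e2.1, fun h => ?_⟩
    -- two successive steps in the same layer would return to the same point
    have e3 : (layers F (s k).1).partner (s k).2 = (s (k + 1)).2 := by
      have := e1.symm.trans e2.1
      rw [← h] at this
      exact place_injective _ this
    have e4 : w.getVert (k + 1 + 1) = w.getVert k := by
      rw [e2.2, ← h, ← e3, Tangle.partner_partner, (hs k (by omega)).1]
    have := hw.getVert_injOn (by simp only [Set.mem_ofPred_eq]; omega)
      (by simp only [Set.mem_ofPred_eq]; omega) e4
    omega

namespace IsTrace

variable {m : ℕ} {pt : ℕ → Fin (F.length + 1) × Fin N} {s : ℕ → Fin F.length × Node N}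

/-- Every edge of a letter that ends in a point of the trace is a step of the trace. -/
theorem exists_step (h : IsTrace F u v m pt s) {k : ℕ} (hk : k ≤ m) {j : Fin F.length}
    {p : Node N} (hp : pt k = place j p) :
    ∃ l < m, (s l).1 = j ∧ ((s l).2 = p ∨ (layers F j).partner (s l).2 = p) := by
  have hpos := h.pos
  have before : ∀ l, l < m → l + 1 = k → (s l).1 = j → ∃ l < m, (s l).1 = j ∧
      ((s l).2 = p ∨ (layers F j).partner (s l).2 = p) := by
    rintro l hl rfl rfl
    exact ⟨l, hl, rfl, .inr (place_injective _ ((h.pt_succ l hl).symm.trans hp))⟩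
  have after : k < m → (s k).1 = j → ∃ l < m, (s l).1 = j ∧
      ((s l).2 = p ∨ (layers F j).partner (s l).2 = p) := by
    rintro hl rfl
    exact ⟨k, hl, rfl, .inl (place_injective _ ((h.pt_eq k hl).symm.trans hp))⟩
  rcases Nat.eq_zero_or_pos k with rfl | hk0
  · exact after hpos (eq_of_place_eq_outer ((h.pt_eq 0 hpos).symm.trans h.pt_zero)
      (hp.symm.trans h.pt_zero))
  obtain ⟨l, rfl⟩ : ∃ l, k = l + 1 := ⟨k - 1, by omega⟩
  rcases hk.eq_or_lt with hkm | hkm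
  · have hend : pt (l + 1) = outer F.length v := hkm ▸ h.pt_end
    exact before l (by omega) rfl (eq_of_place_eq_outer
      ((h.pt_succ l (by omega)).symm.trans hend) (hp.symm.trans hend))
  · rcases eq_or_eq_of_place (hp.symm.trans (h.pt_succ l (by omega)))
      (hp.symm.trans (h.pt_eq _ hkm)) (h.followedBy l hkm).2 with e | e
    · exact before l (by omega) rfl e.symm
    · exact after hkm e.symm

theorem exists_pt_eq_of_reachable (h : IsTrace F u v m pt s) {x : Fin (F.length + 1) × Fin N}
    (hx : (stack (layers F)).Reachable (outer F.length u) x) : ∃ k ≤ m, pt k = x := by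
  obtain ⟨w₀⟩ := hx
  suffices H : ∀ y, (stack (layers F)).Walk y x → (∃ k ≤ m, pt k = y) → ∃ k ≤ m, pt k = x from
    H _ w₀ ⟨0, Nat.zero_le _, h.pt_zero⟩
  intro y w
  clear w₀
  induction w with
  | nil => exact id
  | cons hadj _ ih =>
    rintro ⟨k, hk, rfl⟩
    obtain ⟨j, p, hp, rfl⟩ := hadj
    refine ih ?_
    obtain ⟨l, hl, rfl, rfl | rfl⟩ := h.exists_step hk hp
    · exact ⟨l + 1, hl, h.pt_succ l hl⟩
    · exact ⟨l, hl.le, by rw [Tangle.partner_partner, h.pt_eq l hl]⟩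

theorem reachable (h : IsTrace F u v m pt s) {k : ℕ} (hk : k ≤ m) :
    (stack (layers F)).Reachable (outer F.length u) (pt k) := by
  induction k with
  | zero => rw [h.pt_zero]
  | succ k ih =>
    refine (ih (by omega)).trans (SimpleGraph.Adj.reachable ⟨(s k).1, (s k).2, ?_, ?_⟩)
    · exact h.pt_eq k hk
    · exact h.pt_succ k hk

theorem passesThrough_iff (h : IsTrace F u v m pt s) (j : Fin F.length) :
    PassesThrough F u j ↔ ∃ k < m, (s k).1 = j ∧ stepShift F (s k) ≠ 0 := by
  have hleft := (F.get j).idx_letter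
  constructor
  · have key : ∀ p : Node N, p.col = (F.get j).left →
        (stack (layers F)).Reachable (outer F.length u) (place j p) →
        ∃ k < m, (s k).1 = j ∧ stepShift F (s k) ≠ 0 := by
      intro p hpl hr
      obtain ⟨k, hk, e⟩ := h.exists_pt_eq_of_reachable hr
      obtain ⟨l, hl, rfl, hlp⟩ := h.exists_step hk e
      refine ⟨l, hl, rfl, fun h0 => ?_⟩
      have hc := (F.get (s l).1).edge_cases (s l).2
      have hcol : (s l).2.col = (F.get (s l).1).left := by
        rcases hlp with rfl | rfl
        · exact hpl
        · rw [← hpl]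
          simp only [stepShift, PrimeTangle.shift, layers] at h0 ⊢
          ext
          omega
      rw [hcol] at hc
      simp only [stepShift] at h0
      omega
    rintro (hr | hr)
    · exact key _ rfl hr
    · exact key _ rfl hr
  · rintro ⟨k, hk, rfl, hne⟩
    have hc := (F.get (s k).1).edge_cases (s k).2
    have hr := h.reachable hk.le
    have hr' := h.reachable (Nat.succ_le_of_lt hk)
    rw [h.pt_eq k hk] at hr
    rw [Nat.succ_eq_add_one, h.pt_succ k hk] at hr'
    have key : ∀ p : Node N, p.col = (F.get (s k).1).left →
        (stack (layers F)).Reachable (outer F.length u) (place (s k).1 p) →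
        PassesThrough F u (s k).1 := by
      rintro (c | c) hpl hr
      · exact .inl (hpl ▸ hr)
      · exact .inr (hpl ▸ hr)
    simp only [stepShift, PrimeTangle.shift] at hne hc
    by_cases hcol : (s k).2.col = (F.get (s k).1).left
    · exact key _ hcol hr
    · refine key _ ?_ hr'
      rw [Fin.ext_iff] at hcol ⊢
      simp only [layers]
      omega

theorem col_pt (h : IsTrace F u v m pt s) {k : ℕ} (hk : k < m) :
    (((pt k).2 : ℕ) : ℤ) = ((s k).2.col : ℕ) := by
  rw [h.pt_eq k hk]
  rcases (s k).2 with c | c <;> rfl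

theorem col_pt_succ (h : IsTrace F u v m pt s) {k : ℕ} (hk : k < m) :
    (((pt (k + 1)).2 : ℕ) : ℤ) = ((pt k).2 : ℕ) + stepShift F (s k) := by
  have key : ∀ (j : Fin F.length) (p : Node N), (place j p).2 = p.col := by
    rintro j (c | c) <;> rfl
  rw [h.pt_succ k hk, h.pt_eq k hk, key, key, stepShift, PrimeTangle.shift]
  simp [layers]

theorem stepShift_cases (t : Fin F.length × Node N) :
    stepShift F t = 0 ∨ stepShift F t = 1 ∨ stepShift F t = -1 := by
  have := (F.get t.1).edge_cases t.2
  simp only [stepShift]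
  omega

theorem colDist_start (h : IsTrace F u v m pt s) : colDist u.col (pt 0).2 = 0 := by
  rw [h.pt_zero]
  rcases u with c | c <;> simp [outer, Node.col, colDist]

theorem colDist_end (h : IsTrace F u v m pt s) : colDist u.col (pt m).2 = edgeSize u v := by
  rw [h.pt_end]
  rcases v with c | c <;> rfl

/-- A step along a letter that is not vertical joins the two columns of the letter, so its distances
from the start of the edge are those of the two columns. -/
theorem min_colDist (h : IsTrace F u v m pt s) {k : ℕ} (hk : k < m)
    (hne : stepShift F (s k) ≠ 0) :
    min (colDist u.col (F.get (s k).1).left) (colDist u.col (F.get (s k).1).right) =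
      min (colDist u.col (pt k).2) (colDist u.col (pt (k + 1)).2) := by
  have e1 := h.col_pt hk
  have e2 := h.col_pt_succ hk
  have e3 := (F.get (s k).1).edge_cases (s k).2
  have e4 := (F.get (s k).1).idx_letter
  have e5 := (F.get (s k).1).coe_right
  simp only [stepShift] at *
  unfold colDist
  omega

theorem colDist_succ (h : IsTrace F u v m pt s) {k : ℕ} (hk : k < m) :
    (stepShift F (s k) = 0 ∧ colDist u.col (pt (k + 1)).2 = colDist u.col (pt k).2) ∨
    (stepShift F (s k) ≠ 0 ∧ (colDist u.col (pt (k + 1)).2 = colDist u.col (pt k).2 + 1 ∨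
      colDist u.col (pt k).2 = colDist u.col (pt (k + 1)).2 + 1)) := by
  have e2 := h.col_pt_succ hk
  have e3 := stepShift_cases (s k)
  unfold colDist
  omega

/-- Every distance below the size of the edge is the smaller of the distances of the two columns of
some letter through which the edge passes: the edge has to overcome this distance. -/
theorem exists_passesThrough_min (h : IsTrace F u v m pt s) {d : ℕ} (hd : d < edgeSize u v) :
    ∃ j, PassesThrough F u j ∧
      min (colDist u.col (F.get j).left) (colDist u.col (F.get j).right) = d := by
  have hex : ∃ k, k ≤ m ∧ d < colDist u.col (pt k).2 := ⟨m, le_rfl, by rwa [h.colDist_end]⟩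
  classical
  obtain ⟨hle, hlt⟩ := Nat.find_spec hex
  have hmin := fun k => @Nat.find_min _ _ hex k
  generalize Nat.find hex = k at *
  rcases k with _ | k
  · rw [h.colDist_start] at hlt
    omega
  have hk : k < m := hle
  have h1 : ¬ (k ≤ m ∧ d < colDist u.col (pt k).2) := hmin k (Nat.lt_succ_self k)
  have h2 := h.colDist_succ hk
  have hne : stepShift F (s k) ≠ 0 := by omega
  refine ⟨(s k).1, (h.passesThrough_iff _).2 ⟨k, hk, rfl, hne⟩, ?_⟩
  rw [h.min_colDist hk hne]
  omega

theorem edgeSize_le_ncard (h : IsTrace F u v m pt s) :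
    edgeSize u v ≤ {j | PassesThrough F u j}.ncard := by
  have hsub : (↑(Finset.range (edgeSize u v)) : Set ℕ) ⊆
      (fun j => min (colDist u.col (F.get j).left) (colDist u.col (F.get j).right)) ''
        {j | PassesThrough F u j} := by
    intro d hd
    obtain ⟨j, h1, h2⟩ := h.exists_passesThrough_min (Finset.mem_range.1 hd)
    exact ⟨j, h1, h2⟩
  have h1 := Set.ncard_le_ncard hsub (Set.toFinite _)
  rw [Set.ncard_coe_finset, Finset.card_range] at h1
  exact h1.trans (Set.ncard_image_le (Set.toFinite _))

/-- If the distance from the start never decreases, then at most one letter is passed for each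
distance, as the trace takes only one step away from this distance. -/
theorem ncard_le_edgeSize (h : IsTrace F u v m pt s)
    (hmono : ∀ k < m, colDist u.col (pt k).2 ≤ colDist u.col (pt (k + 1)).2) :
    {j | PassesThrough F u j}.ncard ≤ edgeSize u v := by
  have mono : ∀ l k, k ≤ l → l ≤ m → colDist u.col (pt k).2 ≤ colDist u.col (pt l).2 := by
    intro l k hkl
    induction hkl with
    | refl => exact fun _ => le_rfl
    | step _ ih => exact fun hl => (ih (by omega)).trans (hmono _ hl)
  have key : ∀ k < m, stepShift F (s k) ≠ 0 →
      min (colDist u.col (F.get (s k).1).left) (colDist u.col (F.get (s k).1).right) =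
        colDist u.col (pt k).2 ∧ colDist u.col (pt (k + 1)).2 = colDist u.col (pt k).2 + 1 := by
    intro k hk hne
    have h1 := h.min_colDist hk hne
    have h2 := h.colDist_succ hk
    have h3 := hmono k hk
    omega
  rw [← Finset.card_range (edgeSize u v), ← Set.ncard_coe_finset]
  refine Set.ncard_le_ncard_of_injOn
    (fun j => min (colDist u.col (F.get j).left) (colDist u.col (F.get j).right)) ?_ ?_
    (Finset.finite_toSet _)
  · intro j hj
    obtain ⟨k, hk, rfl, hne⟩ := (h.passesThrough_iff j).1 hj
    obtain ⟨h1, h2⟩ := key k hk hne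
    have h3 := mono m (k + 1) hk le_rfl
    rw [h.colDist_end] at h3
    rw [Finset.mem_coe, Finset.mem_range, h1]
    omega
  · intro j hj j' hj' he
    obtain ⟨k, hk, rfl, hne⟩ := (h.passesThrough_iff j).1 hj
    obtain ⟨k', hk', rfl, hne'⟩ := (h.passesThrough_iff j').1 hj'
    obtain ⟨h1, h2⟩ := key k hk hne
    obtain ⟨h1', h2'⟩ := key k' hk' hne'
    dsimp only at he
    rw [h1, h1'] at he
    rcases lt_trichotomy k k' with hlt | rfl | hlt
    · have := mono k' (k + 1) hlt hk'.le
      omega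
    · rfl
    · have := mono k (k' + 1) hlt hk.le
      omega

/-- If the distance from the start decreases at some step, then some earlier step goes in the
opposite horizontal direction. -/
theorem exists_opposite_step (h : IsTrace F u v m pt s) {k : ℕ} (hk : k < m)
    (hlt : colDist u.col (pt (k + 1)).2 < colDist u.col (pt k).2) :
    ∃ l < m, stepShift F (s l) ≠ 0 ∧ stepShift F (s k) = -stepShift F (s l) := by
  by_contra! hcon
  have h0 := h.colDist_start
  have hs := h.col_pt_succ hk
  have hc := stepShift_cases (s k)
  have hne : stepShift F (s k) ≠ 0 := by
    have := h.colDist_succ hk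
    omega
  have main : ∀ l ≤ k,
      (stepShift F (s k) = 1 → (((pt 0).2 : ℕ) : ℤ) ≤ ((pt l).2 : ℕ)) ∧
      (stepShift F (s k) = -1 → (((pt l).2 : ℕ) : ℤ) ≤ ((pt 0).2 : ℕ)) := by
    intro l hl
    induction l with
    | zero => simp
    | succ l ih =>
      have h1 := ih (by omega)
      rw [h.col_pt_succ (by omega : l < m)]
      have h2 := hcon l (by omega)
      have h3 := stepShift_cases (s l)
      omega
  have := main k le_rfl
  unfold colDist at h0 hlt
  omega

end IsTrace

/-! ### Minimal factorizations -/

theorem numT_add_numU (F : List (PrimeTangle N)) (u : Node N) :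
    numT F u + numU F u = {j | PassesThrough F u j}.ncard := by
  have hTU : ∀ p : PrimeTangle N, p.IsT ↔ ¬ p.IsU := by
    rintro (_ | _) <;> simp [PrimeTangle.IsT, PrimeTangle.IsU]
  rw [numT, numU, ← Set.ncard_union_eq _ (Set.toFinite _) (Set.toFinite _)]
  · congr 1
    ext j
    simp only [Set.mem_union, Set.mem_ofPred_eq, hTU]
    exact ⟨fun h => h.elim And.right And.right, fun h =>
      (em _).elim (fun h' => .inr ⟨h', h⟩) fun h' => .inl ⟨h', h⟩⟩
  · rw [Set.disjoint_left]
    rintro j ⟨h1, -⟩ ⟨h2, -⟩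
    exact (hTU _).1 h1 h2

theorem IsMinimalFactorization.not_comesBack {X : Tangle N} (hF : IsMinimalFactorization F X)
    (huv : u ≠ v) (hU : 0 < numU F u) : ¬ ComesBack F u v := by
  rintro ⟨-, w, hw, d, hd, -, hlt⟩
  obtain ⟨j, hjU, hj⟩ := Set.nonempty_of_ncard_ne_zero hU.ne'
  obtain ⟨s, hs⟩ := hw.exists_isTrace (by rintro rfl; exact j.elim0) huv
  obtain ⟨k₁, hk₁, rfl, hne⟩ := (hs.passesThrough_iff j).1 hj
  obtain ⟨k, hk, rfl⟩ := List.mem_iff_getElem.1 hd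
  rw [SimpleGraph.Walk.darts_getElem_eq_getVert] at hlt
  rw [SimpleGraph.Walk.length_darts] at hk
  obtain ⟨l, hl, h1, h2⟩ := hs.exists_opposite_step hk hlt
  refine hF.not_reducible (reducible_of_hook hs.followedBy hk₁ hl hk ?_ h1 h2)
  have hc := (F.get (s k₁).1).edge_cases (s k₁).2
  have hx : ¬ (F.get (s k₁).1).letter = cross (F.get (s k₁).1).letter.idx := by
    generalize F.get (s k₁).1 = p at hjU
    cases p <;> simp_all [PrimeTangle.IsU, PrimeTangle.letter]
  simp only [IsHookStep, stepShift] at *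
  tauto

end Words

theorem mainTheorem3 {N : ℕ} (X : Tangle N) (F : List (PrimeTangle N))
    (hF : IsMinimalFactorization F X) (u v : Node N) (he : X.partner u = v) :
    (0 < numU F u → ¬ ComesBack F u v) ∧
    (edgeSize u v ≤ numT F u → numU F u = 0) ∧
    (numT F u < edgeSize u v → numT F u + numU F u = edgeSize u v) := by
  have huv : u ≠ v := fun h => X.partner_ne u (he.trans h.symm)
  have h1 : 0 < numU F u → ¬ ComesBack F u v := hF.not_comesBack huv
  have hreach := hF.1 u
  rw [he] at hreach
  obtain ⟨w, hw⟩ := hreach.exists_isPath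
  have hsum := numT_add_numU F u
  have heq : 0 < numU F u → numT F u + numU F u = edgeSize u v := by
    intro hU
    obtain ⟨j, -⟩ := Set.nonempty_of_ncard_ne_zero hU.ne'
    obtain ⟨s, hs⟩ := hw.exists_isTrace (by rintro rfl; exact j.elim0) huv
    rw [hsum]
    refine le_antisymm (hs.ncard_le_edgeSize fun k hk => ?_) hs.edgeSize_le_ncard
    by_contra! hlt
    refine h1 hU ⟨(s k).1, w, hw, ⟨(w.getVert k, w.getVert (k + 1)), w.adj_getVert_succ hk⟩, ?_,
      ⟨(s k).2, hs.pt_eq k hk, hs.pt_succ k hk⟩, hlt⟩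
    rw [← SimpleGraph.Walk.darts_getElem_eq_getVert k (by simpa using hk)]
    exact List.getElem_mem _
  have hle : edgeSize u v ≤ numT F u + numU F u := by
    rcases eq_or_ne F [] with rfl | hne
    · have : (outer 0 u).2 = (outer 0 v).2 := by
        have hbot : stack (layers ([] : List (PrimeTangle N))) = ⊥ := by
          ext a b
          simp only [SimpleGraph.bot_adj, iff_false]
          rintro ⟨j, -⟩
          exact j.elim0
        rw [hbot, SimpleGraph.reachable_bot] at hreach
        exact congrArg Prod.snd hreach
      have hcol : ∀ q : Node N, (outer 0 q).2 = q.col := by rintro (k | k) <;> rfl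
      rw [hcol, hcol] at this
      simp [edgeSize, this, colDist]
    · obtain ⟨s, hs⟩ := hw.exists_isTrace hne huv
      rw [hsum]
      exact hs.edgeSize_le_ncard
  refine ⟨h1, ?_, ?_⟩ <;> omega
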